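/- Let $T$ be a finite tree with at least two vertices. A total forcing set of $T$ is a set $S$ of vertices such that the subgraph of $T$ induced by $S$ has no isolated vertex and such that, starting with exactly the vertices of $S$ colored and repeatedly letting a colored vertex with exactly one uncolored neighbor color this neighbor, all vertices of $T$ eventually become colored. Let $F_t(T)$ be the minimum cardinality of a total forcing set of $T$, let $\alpha'(T)$ be the matching number of $T$ (the maximum number of edges in a matching), and let $\mathrm{pc}(T)$ be the path cover number of $T$, that is, the minimum number of paths (single vertices allowed) in $T$ such that every vertex of $T$ belongs to exactly one of them. Then \[F_t(T) \le \alpha'(T) + \mathrm{pc}(T),\] with equality if and only if $T \in \mathcal{T}$. Here $\mathcal{T}$ is the family that consists of $K_2$ and of all trees obtained from a tree $T'$ (possibly with only one vertex) and a set $A \subseteq V(T')$, where either $A = V(T')$ or $V(T') \setminus A$ is an independent set of $T'$ containing no leaf (vertex of degree $1$) of $T'$, by attaching at least two pendant edges to each vertex of $A$ (the numbers may differ from vertex to vertex) and none to the other vertices of $T'$. -/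

import Mathlib

namespace TotalForcing

/-- The vertices coloured by the forcing process started from the set `S`: the vertices of `S` are
coloured, and a coloured vertex `u` forces its neighbour `v` to become coloured as soon as every
neighbour of `u` other than `v` is coloured. -/
inductive Colored {V : Type*} (G : SimpleGraph V) (S : Set V) : V → Prop
  | initial (v : V) (hv : v ∈ S) : Colored G S v
  | force (u v : V) (hu : Colored G S u) (huv : G.Adj u v)
      (h : ∀ w, G.Adj u w → w ≠ v → Colored G S w) : Colored G S v

/-- `S` is a (zero) forcing set: the forcing process started from `S` colours every vertex. -/
def IsForcingSet {V : Type*} (G : SimpleGraph V) (S : Set V) : Prop :=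
  ∀ v, Colored G S v

/-- `S` is a total forcing set: a forcing set that induces a subgraph without isolated vertices. -/
def IsTotalForcingSet {V : Type*} (G : SimpleGraph V) (S : Set V) : Prop :=
  IsForcingSet G S ∧ ∀ v ∈ S, ∃ w ∈ S, G.Adj v w

/-- The total forcing number: the minimum cardinality of a total forcing set. (In a finite graph
without isolated vertices the set of all vertices is a total forcing set.) -/
noncomputable def totalForcingNumber {V : Type*} (G : SimpleGraph V) : ℕ :=
  sInf {n | ∃ S : Finset V, IsTotalForcingSet G (S : Set V) ∧ S.card = n}

/-- The matching number: the maximum number of edges of a matching. -/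
noncomputable def matchingNumber {V : Type*} (G : SimpleGraph V) : ℕ :=
  sSup {n | ∃ M : G.Subgraph, M.IsMatching ∧ M.edgeSet.ncard = n}

/-- `P` is a path of `G` (possibly with a single vertex), regarded as a subgraph. -/
def IsPathSubgraph {V : Type*} {G : SimpleGraph V} (P : G.Subgraph) : Prop :=
  ∃ (u v : V) (p : G.Walk u v), p.IsPath ∧ p.toSubgraph = P

/-- `C` is a path cover of `G`: a collection of paths such that every vertex of `G` belongs to
exactly one of them. -/
def IsPathCover {V : Type*} (G : SimpleGraph V) (C : Finset G.Subgraph) : Prop :=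
  (∀ P ∈ C, IsPathSubgraph P) ∧ ∀ v : V, ∃! P, P ∈ C ∧ v ∈ P.verts

/-- The path cover number: the minimum cardinality of a path cover. -/
noncomputable def pathCoverNumber {V : Type*} (G : SimpleGraph V) : ℕ :=
  sInf {n | ∃ C : Finset G.Subgraph, IsPathCover G C ∧ C.card = n}

/-- The graph obtained from `G` by attaching `k w` pendant edges to each vertex `w`. The vertex
`Sum.inl w` is the vertex `w` of `G`, and the vertices `Sum.inr ⟨w, i⟩` with `i < k w` are the new
leaves, each adjacent to `w` only. -/
def attachPendant {W : Type*} (G : SimpleGraph W) (k : W → ℕ) :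
    SimpleGraph (W ⊕ (Σ w : W, Fin (k w))) where
  Adj
    | Sum.inl a, Sum.inl b => G.Adj a b
    | Sum.inl a, Sum.inr x => x.1 = a
    | Sum.inr x, Sum.inl a => x.1 = a
    | Sum.inr _, Sum.inr _ => False
  symm := ⟨by
    rintro (a | x) (b | y) h
    · exact SimpleGraph.Adj.symm h
    · exact h
    · exact h
    · exact h⟩
  loopless := ⟨by
    rintro (a | x) h
    · exact G.irrefl h
    · exact h⟩

/-- `v` is a leaf of `G`: it has exactly one neighbour. -/
def IsLeaf {V : Type*} (G : SimpleGraph V) (v : V) : Prop :=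
  ∃! w, G.Adj v w

/-- Membership in the family `𝒯`: the graph is `K₂`, or it arises from a finite tree `T'` (possibly
with a single vertex) by attaching at least two pendant edges to each vertex of a set `A` of
vertices of `T'` (and none to the other vertices), where `A` is the whole vertex set of `T'` or the
complement of `A` is an independent set of `T'` that contains no leaf of `T'`. -/
def InFamily {V : Type*} (T : SimpleGraph V) : Prop :=
  Nonempty (T ≃g (⊤ : SimpleGraph (Fin 2))) ∨
    ∃ (m : ℕ) (T' : SimpleGraph (Fin m)) (A : Set (Fin m)) (k : Fin m → ℕ),
      T'.IsTree ∧
      (A = Set.univ ∨ (T'.IsIndepSet Aᶜ ∧ ∀ w ∈ Aᶜ, ¬ IsLeaf T' w)) ∧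
      (∀ w ∈ A, 2 ≤ k w) ∧ (∀ w ∉ A, k w = 0) ∧
      Nonempty (T ≃g attachPendant T' k)

end TotalForcing

/-!
# Total forcing in trees

A path cover is handled as a list `L` of vertex lists, one per path (`IsListCover`). In a tree, the
first vertices of the paths of any path cover, however the paths are oriented, form a forcing set
(`IsListCover.isForcingSet`). Indeed, suppose the process stops early. Then every uncoloured vertex
has a predecessor on its path, and a coloured vertex with an uncoloured successor must have another
uncoloured neighbour. Moving from uncoloured vertices to their predecessors, and from coloured ones
to such other neighbours, gives an endless walk in the tree without backtracking, which is
impossible (`exists_apply_apply_eq_self`).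

*Upper bound.* Take a path cover with the fewest paths and, among those, the fewest one-vertex
paths (`IsOptimalCover`). Any neighbour of a one-vertex path is the middle of a three-vertex path,
since otherwise two paths could be merged or recombined. Hence the first two vertices of every
path form a total forcing set, of size `∑ min 2 |P| ≤ ∑ (|P| / 2 + 1)`. The paths contain disjoint
edges, `|P| / 2` of them in `P`, so the right-hand side (`budget`) is at most the sum of the
matching number and the path cover number.

*Equality.* If the bound is attained, no path has four or more vertices. If some path `x y` has two
vertices, then the tree is `K₂`: a further neighbour `z` of `x` would be the middle of a path
`a z b`, and replacing the two paths by `a z x y` and `b` would give a smaller total forcing set.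
Otherwise all paths have one or three vertices, and the set `C` of the middles meets every edge.
Each `c ∈ C` is adjacent to two leaves: otherwise the path through `c` can be chosen as `a c b`,
where `b` is the only leaf at `c` if there is one, and then `a` together with the first two
vertices of the other paths is a smaller total forcing set
(`IsListCover.totalForcingNumber_lt_budget`). A set `C` that meets every edge and each of whose
members has two leaves (`IsPendantCover`) is the same thing as a presentation of the tree as a
member of the family (`IsPendantCover.inFamily`, `exists_isPendantCover_of_iso`).

*Lower bound for the family.* Given such a set `C` in a graph with `n` vertices, every total
forcing set contains `C`, so only vertices of `C` colour new vertices, at most one each, and the total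
forcing number is at least `n - |C|`. The matching number is at most `|C|`, and the paths
leaf-`c`-leaf together with single vertices show that the path cover number is at most
`n - 2 |C|`.
-/

namespace TotalForcing

open SimpleGraph

/-! ### Non-backtracking maps on a forest -/

/-- A map that moves each vertex of a nonempty set `N` in a finite forest to a neighbour in `N` has to
backtrack somewhere: its orbits are walks, and a walk in a forest that never backtracks is a path,
whose length is less than the number of vertices. -/
theorem exists_apply_apply_eq_self {V : Type*} [Finite V] {G : SimpleGraph V} (hG : G.IsAcyclic)
    {N : Set V} (hN : N.Nonempty) (f : V → V) (hmem : ∀ v ∈ N, f v ∈ N)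
    (hadj : ∀ v ∈ N, G.Adj v (f v)) : ∃ v ∈ N, f (f v) = v := by
  by_contra! hne
  have walk : ∀ (n : ℕ), ∀ v ∈ N, ∃ (w : V) (p : G.Walk v w), p.length = n ∧
      p.edges.IsChain (· ≠ ·) ∧ ∀ e ∈ p.edges.head?, e = s(v, f v) := by
    intro n
    induction n with
    | zero => exact fun v _ => ⟨v, .nil, by simp⟩
    | succ n ih =>
      intro v hv
      obtain ⟨w, p, hp, hc, hh⟩ := ih (f v) (hmem v hv)
      refine ⟨w, .cons (hadj v hv) p, by simp [hp], ?_, by simp⟩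
      rw [Walk.edges_cons, List.isChain_cons]
      refine ⟨fun e he h => ?_, hc⟩
      rw [hh e he, Sym2.eq_iff] at h
      rcases h with ⟨h1, -⟩ | ⟨h1, -⟩
      · exact (hadj v hv).ne h1
      · exact hne v hv h1.symm
  obtain ⟨v, hv⟩ := hN
  have := Fintype.ofFinite V
  obtain ⟨w, p, hp, hc, -⟩ := walk (Fintype.card V) v hv
  exact (((hG.isPath_iff_isChain p).2 hc).length_lt).ne hp

/-! ### Covers by vertex lists -/

/-- A path cover given by vertex lists: each list in `L` is the nonempty sequence of vertices of an
oriented path of `G`, and every vertex of `G` occurs exactly once in all lists together. In an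
arbitrary graph the lists need not be induced paths. -/
structure IsListCover {V : Type*} (G : SimpleGraph V) (L : List (List V)) : Prop where
  ne_nil : ∀ P ∈ L, P ≠ []
  chain : ∀ P ∈ L, P.IsChain G.Adj
  nodup : L.flatten.Nodup
  mem : ∀ v, v ∈ L.flatten

variable {V : Type*} {G : SimpleGraph V} {L : List (List V)}

/-- Some members `A` of a list cover may be replaced by other paths `A'` on the same vertices. -/
theorem IsListCover.replace (h : IsListCover G L) {A A' R : List (List V)} (hL : L.Perm (A ++ R))
    (hA : A'.flatten.Perm A.flatten) (hne : ∀ P ∈ A', P ≠ [])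
    (hch : ∀ P ∈ A', P.IsChain G.Adj) : IsListCover G (A' ++ R) := by
  have hp : (A' ++ R).flatten.Perm L.flatten := by
    refine .trans ?_ hL.flatten.symm
    simpa using hA.append_right _
  refine ⟨fun P hP => ?_, fun P hP => ?_, hp.nodup_iff.2 h.nodup, fun v => hp.mem_iff.2 (h.mem v)⟩
  · rcases List.mem_append.1 hP with hP | hP
    · exact hne P hP
    · exact h.ne_nil P (hL.mem_iff.2 (by simp [hP]))
  · rcases List.mem_append.1 hP with hP | hP
    · exact hch P hP
    · exact h.chain P (hL.mem_iff.2 (by simp [hP]))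

theorem IsListCover.perm (h : IsListCover G L) {L' : List (List V)} (hL : L.Perm L') :
    IsListCover G L' :=
  h.replace (A := []) (A' := []) (R := L') hL (.refl _) (by simp) (by simp)

theorem IsListCover.eq_of_mem (h : IsListCover G L) {P Q : List V} (hP : P ∈ L) (hQ : Q ∈ L)
    {v : V} (hvP : v ∈ P) (hvQ : v ∈ Q) : P = Q := by
  by_contra hne
  have : Std.Symm (List.Disjoint (α := V)) := ⟨fun _ _ h => h.symm⟩
  exact (List.nodup_flatten.1 h.nodup).2.forall hP hQ hne hvP hvQ

theorem IsListCover.exists_mem (h : IsListCover G L) (v : V) : ∃ P ∈ L, v ∈ P :=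
  List.mem_flatten.1 (h.mem v)

theorem exists_perm_cons {α : Type*} {l : List α} {a : α} (h : a ∈ l) :
    ∃ r, l.Perm (a :: r) := by
  classical exact ⟨_, List.perm_cons_erase h⟩

theorem exists_perm_cons_cons {α : Type*} {l : List α} {a b : α} (ha : a ∈ l) (hb : b ∈ l)
    (hab : a ≠ b) : ∃ r, l.Perm (a :: b :: r) := by
  obtain ⟨r, hr⟩ := exists_perm_cons ha
  have : b ∈ r := by
    have := hr.mem_iff.1 hb
    simpa [hab.symm] using this
  obtain ⟨s, hs⟩ := exists_perm_cons this
  exact ⟨s, hr.trans (hs.cons a)⟩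

/-- `v` is the successor of `u` on one of the lists in `L`. -/
def Next (L : List (List V)) (u v : V) : Prop :=
  ∃ P ∈ L, ∃ i, P[i]? = some u ∧ P[i + 1]? = some v

theorem IsListCover.index_unique (h : IsListCover G L) {P Q : List V} (hP : P ∈ L) (hQ : Q ∈ L)
    {v : V} {i j : ℕ} (hi : P[i]? = some v) (hj : Q[j]? = some v) : P = Q ∧ i = j := by
  have := h.eq_of_mem hP hQ (List.mem_of_getElem? hi) (List.mem_of_getElem? hj)
  subst this
  exact ⟨rfl, (List.getElem?_inj (List.getElem?_eq_some_iff.1 hi).1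
    ((List.nodup_flatten.1 h.nodup).1 P hP)).1 (hi.trans hj.symm)⟩

theorem IsListCover.next_unique (h : IsListCover G L) {u v w : V} (hv : Next L u v)
    (hw : Next L u w) : v = w := by
  obtain ⟨P, hP, i, hi, hi'⟩ := hv
  obtain ⟨Q, hQ, j, hj, hj'⟩ := hw
  obtain ⟨rfl, rfl⟩ := h.index_unique hP hQ hi hj
  exact Option.some.inj (hi'.symm.trans hj')

theorem IsListCover.next_asymm (h : IsListCover G L) {u v : V} (hv : Next L u v) :
    ¬ Next L v u := by
  rintro ⟨Q, hQ, j, hj, hj'⟩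
  obtain ⟨P, hP, i, hi, hi'⟩ := hv
  have h1 := (h.index_unique hP hQ hi hj').2
  have h2 := (h.index_unique hP hQ hi' hj).2
  omega

theorem IsListCover.next_adj (h : IsListCover G L) {u v : V} (hv : Next L u v) : G.Adj u v := by
  obtain ⟨P, hP, i, hi, hi'⟩ := hv
  obtain ⟨h1, rfl⟩ := List.getElem?_eq_some_iff.1 hi
  obtain ⟨h2, rfl⟩ := List.getElem?_eq_some_iff.1 hi'
  exact (h.chain P hP).getElem i h2

theorem IsListCover.exists_next (h : IsListCover G L) {v : V} (hv : ∀ P ∈ L, P.head? ≠ some v) :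
    ∃ u, Next L u v := by
  obtain ⟨P, hP, hvP⟩ := h.exists_mem v
  obtain ⟨i, hi, rfl⟩ := List.mem_iff_getElem.1 hvP
  rcases i with - | i
  · exact absurd (by rw [List.head?_eq_getElem?, List.getElem?_eq_getElem hi]) (hv P hP)
  · exact ⟨P[i], P, hP, i, by simp, by simp⟩

/-- In a forest, the first vertices of the paths of a list cover form a forcing set. -/
theorem IsListCover.isForcingSet [Finite V] (hG : G.IsAcyclic) (h : IsListCover G L) {S : Set V}
    (hS : ∀ P ∈ L, ∀ v ∈ P.head?, v ∈ S) : IsForcingSet G S := by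
  by_contra hF
  obtain ⟨v₀, hv₀⟩ := not_forall.1 hF
  set W : Set V := {v | ¬ Colored G S v} with hW
  -- `W` consists of the vertices that stay uncoloured.
  have hpred : ∀ v ∈ W, ∃ u, Next L u v := fun v hv =>
    h.exists_next fun P hP hPv => hv (.initial v (hS P hP v hPv))
  have hstuck : ∀ u v, u ∉ W → v ∈ W → Next L u v → ∃ w ∈ W, G.Adj u w ∧ w ≠ v := by
    intro u v hu hv huv
    by_contra! hw
    refine hv (.force u v (not_not.1 hu) (h.next_adj huv) fun w huw hne => ?_)
    by_contra hc
    exact hne (hw w hc huw)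
  -- An uncoloured vertex goes back along its path, a coloured one leaves the path sideways.
  have hf : ∀ v, ∃ u, (v ∈ W → Next L u v) ∧
      (v ∉ W → (∃ w ∈ W, Next L v w) → u ∈ W ∧ G.Adj v u ∧ ¬ Next L v u) := by
    intro v
    by_cases hv : v ∈ W
    · obtain ⟨u, hu⟩ := hpred v hv
      exact ⟨u, fun _ => hu, fun h => absurd hv h⟩
    · by_cases hw : ∃ w ∈ W, Next L v w
      · obtain ⟨w, hwW, hvw⟩ := hw
        obtain ⟨u, huW, hvu, hne⟩ := hstuck v w hv hwW hvw
        exact ⟨u, fun h => absurd h hv, fun _ _ => ⟨huW, hvu, fun h' => hne (h.next_unique h' hvw)⟩⟩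
      · exact ⟨v, fun h => absurd h hv, fun _ h => absurd h hw⟩
  choose f hf1 hf2 using hf
  obtain ⟨v, hv, hvv⟩ := exists_apply_apply_eq_self hG
    (N := {v | v ∈ W ∨ ∃ w ∈ W, Next L v w}) ⟨v₀, Or.inl hv₀⟩ f
    (fun v hv => by
      by_cases hvW : v ∈ W
      · exact Or.inr ⟨v, hvW, hf1 v hvW⟩
      · exact Or.inl (hf2 v hvW (hv.resolve_left hvW)).1)
    (fun v hv => by
      by_cases hvW : v ∈ W
      · exact (h.next_adj (hf1 v hvW)).symm
      · exact (hf2 v hvW (hv.resolve_left hvW)).2.1)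
  by_cases hvW : v ∈ W
  · have h1 := hf1 v hvW
    by_cases hu : f v ∈ W
    · have h2 := hf1 _ hu
      rw [hvv] at h2
      exact h.next_asymm h1 h2
    · have h2 := (hf2 _ hu ⟨v, hvW, h1⟩).2.2
      rw [hvv] at h2
      exact h2 h1
  · obtain ⟨h1, -, h3⟩ := hf2 v hvW (hv.resolve_left hvW)
    have h4 := hf1 _ h1
    rw [hvv] at h4
    exact h3 h4

/-! ### List covers and the three parameters -/

theorem IsPathCover.exists_isListCover {C : Finset G.Subgraph} (hC : IsPathCover G C) :
    ∃ L, IsListCover G L ∧ L.length = C.card := by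
  have hex : ∀ P : G.Subgraph, ∃ l : List V, P ∈ C →
      l ≠ [] ∧ l.IsChain G.Adj ∧ l.Nodup ∧ ∀ v, v ∈ l ↔ v ∈ P.verts := by
    intro P
    by_cases hP : P ∈ C
    · obtain ⟨u, v, p, hp, rfl⟩ := hC.1 P hP
      exact ⟨p.support, fun _ => ⟨p.support_ne_nil, p.isChain_adj_support, hp.support_nodup,
        fun v => p.mem_verts_toSubgraph.symm⟩⟩
    · exact ⟨[], fun h => absurd h hP⟩
  choose l hl using hex
  refine ⟨C.toList.map l, ⟨?_, ?_, ?_, ?_⟩, by simp⟩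
  · simp only [List.mem_map, Finset.mem_toList]
    rintro _ ⟨P, hP, rfl⟩
    exact (hl P hP).1
  · simp only [List.mem_map, Finset.mem_toList]
    rintro _ ⟨P, hP, rfl⟩
    exact (hl P hP).2.1
  · rw [List.nodup_flatten]
    refine ⟨?_, ?_⟩
    · simp only [List.mem_map, Finset.mem_toList]
      rintro _ ⟨P, hP, rfl⟩
      exact (hl P hP).2.2.1
    · rw [List.pairwise_map]
      refine C.nodup_toList.imp_of_mem fun {P Q} hP hQ hne v hvP hvQ => hne ?_
      rw [Finset.mem_toList] at hP hQ
      exact (hC.2 v).unique ⟨hP, ((hl P hP).2.2.2 v).1 hvP⟩ ⟨hQ, ((hl Q hQ).2.2.2 v).1 hvQ⟩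
  · intro v
    obtain ⟨P, ⟨hP, hv⟩, -⟩ := hC.2 v
    exact List.mem_flatten.2 ⟨l P, List.mem_map_of_mem (by simpa using hP),
      ((hl P hP).2.2.2 v).2 hv⟩

/-- The disjoint pairs `(v₁, v₂), (v₃, v₄), …` of consecutive entries of a list; the last entry of a
list of odd length is dropped. -/
def pairUp : List V → List (V × V)
  | a :: b :: l => (a, b) :: pairUp l
  | _ => []

theorem length_pairUp : ∀ P : List V, (pairUp P).length = P.length / 2
  | [] => by simp [pairUp]
  | [_] => by simp [pairUp]
  | a :: b :: l => by
    simp only [pairUp, List.length_cons, length_pairUp l]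
    omega

theorem pairUp_sublist : ∀ P : List V, ((pairUp P).flatMap fun e => [e.1, e.2]).Sublist P
  | [] => by simp [pairUp]
  | [_] => by simp [pairUp]
  | a :: b :: l => by
    simpa [pairUp] using pairUp_sublist l

theorem adj_of_mem_pairUp : ∀ P : List V, P.IsChain G.Adj → ∀ e ∈ pairUp P, G.Adj e.1 e.2
  | [], _ => by simp [pairUp]
  | [_], _ => by simp [pairUp]
  | a :: b :: l, h => by
    rw [List.isChain_cons_cons] at h
    simp only [pairUp, List.mem_cons, forall_eq_or_imp]
    exact ⟨h.1, adj_of_mem_pairUp l h.2.tail⟩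

theorem exists_isMatching : ∀ E : List (V × V), (∀ e ∈ E, G.Adj e.1 e.2) →
    (E.flatMap fun e => [e.1, e.2]).Nodup → ∃ M : G.Subgraph, M.IsMatching ∧
      (∀ v, v ∈ M.verts ↔ v ∈ E.flatMap fun e => [e.1, e.2]) ∧ M.edgeSet.ncard = E.length
  | [], _, _ => ⟨⊥, by simp [Subgraph.IsMatching], by simp, by simp⟩
  | (a, b) :: E, hadj, hnd => by
    rw [List.flatMap_cons, List.nodup_append'] at hnd
    obtain ⟨M, hM, hMv, hMe⟩ :=
      exists_isMatching E (fun e he => hadj e (List.mem_cons_of_mem _ he)) hnd.2.1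
    have hab : G.Adj a b := hadj (a, b) (by simp)
    have hdisj : ∀ v, v = a ∨ v = b → v ∉ M.verts := by
      intro v hv hvM
      exact hnd.2.2 (by simpa using hv) ((hMv v).1 hvM)
    have hm := Subgraph.IsMatching.subgraphOfAdj hab
    refine ⟨G.subgraphOfAdj hab ⊔ M, hm.sup hM ?_, fun v => ?_, ?_⟩
    · rw [hm.support_eq_verts, hM.support_eq_verts, Set.disjoint_left]
      intro v hv
      exact hdisj v (by simpa using hv)
    · simp only [Subgraph.verts_sup, Set.mem_union, hMv, List.flatMap_cons, List.mem_append]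
      simp
    · have hnot : s(a, b) ∉ M.edgeSet := fun h => hdisj a (Or.inl rfl) (M.edge_vert h)
      have hfin : M.edgeSet.Finite := by
        have : M.verts.Finite := by
          refine (List.finite_toSet (E.flatMap fun e => [e.1, e.2])).subset fun v hv => ?_
          exact (hMv v).1 hv
        refine (Set.Finite.image (fun p : V × V => s(p.1, p.2)) (this.prod this)).subset ?_
        intro e
        induction e with | _ u v =>
        exact fun h => ⟨(u, v), ⟨M.edge_vert h, M.edge_vert h.symm⟩, rfl⟩
      rw [Subgraph.edgeSet_sup, edgeSet_subgraphOfAdj, Set.singleton_union,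
        Set.ncard_insert_of_notMem hnot hfin, hMe, List.length_cons]

/-- Every second edge of each path of a list cover yields a matching. -/
theorem IsListCover.sum_length_div_two_le [Finite V] (h : IsListCover G L) :
    (L.map fun P => P.length / 2).sum ≤ matchingNumber G := by
  obtain ⟨M, hM, -, hcard⟩ := exists_isMatching (G := G) (L.flatMap pairUp)
    (fun e he => by
      obtain ⟨P, hP, heP⟩ := List.mem_flatMap.1 he
      exact adj_of_mem_pairUp P (h.chain P hP) e heP)
    (by
      refine List.Sublist.nodup ?_ h.nodup
      rw [List.flatMap_assoc]
      clear h
      induction L with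
      | nil => simp
      | cons P L ih => simpa using (pairUp_sublist P).append ih)
  have hbdd : BddAbove {n | ∃ M : G.Subgraph, M.IsMatching ∧ M.edgeSet.ncard = n} := by
    refine ⟨Nat.card (Sym2 V), ?_⟩
    rintro _ ⟨M, -, rfl⟩
    exact Set.ncard_le_card _
  refine le_trans (le_of_eq ?_) (le_csSup hbdd ⟨M, hM, rfl⟩)
  rw [hcard, List.length_flatMap]
  simp [length_pairUp]

theorem totalForcingNumber_le_length {s : List V} (hs : IsTotalForcingSet G {v | v ∈ s}) :
    totalForcingNumber G ≤ s.length := by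
  classical
  have hs' : IsTotalForcingSet G (s.toFinset : Set V) := by simpa using hs
  unfold totalForcingNumber
  exact le_trans (Nat.sInf_le ⟨s.toFinset, hs', rfl⟩) s.toFinset_card_le

/-! ### Optimal list covers -/

/-- The number of one-vertex paths among the lists in `L`. -/
def singletonCount (L : List (List V)) : ℕ := L.countP fun P => P.length = 1

/-- A list cover with the fewest paths and, among those, with the fewest one-vertex paths. -/
structure IsOptimalCover (G : SimpleGraph V) (L : List (List V)) : Prop
    extends IsListCover G L where
  length_le : ∀ L', IsListCover G L' → L.length ≤ L'.length
  singletonCount_le : ∀ L', IsListCover G L' → L'.length = L.length →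
    singletonCount L ≤ singletonCount L'

theorem IsListCover.exists_isOptimalCover (h : IsListCover G L) : ∃ L', IsOptimalCover G L' := by
  have wf : WellFounded (InvImage (Prod.Lex (· < ·) (· < ·))
      fun L : List (List V) => (L.length, singletonCount L)) :=
    InvImage.wf _ (WellFounded.prod_lex wellFounded_lt wellFounded_lt)
  obtain ⟨M, hM, hmin⟩ := wf.has_min {L | IsListCover G L} ⟨L, h⟩
  refine ⟨M, hM, fun L' hL' => ?_, fun L' hL' hlen => ?_⟩
  · by_contra! hlt
    exact hmin L' hL' (Prod.Lex.left _ _ hlt)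
  · by_contra! hlt
    refine hmin L' hL' ?_
    simp only [InvImage, hlen]
    exact Prod.Lex.right _ hlt

theorem isChain_reverse_iff (P : List V) : P.reverse.IsChain G.Adj ↔ P.IsChain G.Adj := by
  simp [List.isChain_reverse, G.adj_comm]

/-- `x` is the first or the last entry of the list `P`. -/
def IsEnd (x : V) (P : List V) : Prop := ∃ l, P = x :: l ∨ P = l ++ [x]

/-- Two paths with adjacent ends could be merged, after reversing them if necessary. -/
theorem IsOptimalCover.not_adj_of_isEnd (h : IsOptimalCover G L) {P Q : List V} (hP : P ∈ L)
    (hQ : Q ∈ L) (hPQ : P ≠ Q) {x y : V} (hx : IsEnd x P) (hy : IsEnd y Q) : ¬ G.Adj x y := by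
  intro hxy
  obtain ⟨l, hlP, hlc⟩ : ∃ l, (l ++ [x]).Perm P ∧ (l ++ [x]).IsChain G.Adj := by
    obtain ⟨l, rfl | rfl⟩ := hx
    · refine ⟨l.reverse, ?_, ?_⟩
      · rw [← List.reverse_cons]
        exact List.reverse_perm _
      · rw [← List.reverse_cons, isChain_reverse_iff]
        exact h.chain _ hP
    · exact ⟨l, .refl _, h.chain _ hP⟩
  obtain ⟨m, hmQ, hmc⟩ : ∃ m, (y :: m).Perm Q ∧ (y :: m).IsChain G.Adj := by
    obtain ⟨m, rfl | rfl⟩ := hy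
    · exact ⟨m, .refl _, h.chain _ hQ⟩
    · refine ⟨m.reverse, ?_, ?_⟩
      · simpa using List.reverse_perm (m ++ [y])
      · have := (isChain_reverse_iff _).2 (h.chain _ hQ)
        simpa using this
  obtain ⟨R, hR⟩ := exists_perm_cons_cons hP hQ hPQ
  have := h.length_le _ (h.replace (A := [P, Q]) (A' := [(l ++ [x]) ++ y :: m]) (R := R) hR
    (by simpa using hlP.append hmQ) (by simp)
    (by
      simp only [List.mem_singleton, forall_eq]
      rw [List.isChain_append]
      exact ⟨hlc, hmc, by simpa using hxy⟩))
  rw [hR.length_eq] at this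
  simp at this

/-- If `v` were adjacent to `x`, the paths `v` and `l x r` could be recombined into `l` and `v x r`,
which have at least two vertices each. The list `l ++ x :: r` is only required to be a
rearrangement of `P`, so that the statement also applies to the reversal of `P`. -/
theorem IsOptimalCover.not_adj_middle (h : IsOptimalCover G L) {P l r : List V} {v x : V}
    (hv : [v] ∈ L) (hP : P ∈ L) (hne : [v] ≠ P) (hPerm : (l ++ x :: r).Perm P)
    (hc : (l ++ x :: r).IsChain G.Adj) (hl : 2 ≤ l.length) : ¬ G.Adj v x := by
  intro hvx
  obtain ⟨R, hR⟩ := exists_perm_cons_cons hv hP hne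
  have hc' := List.isChain_append.1 hc
  have hcov : IsListCover G ([l, v :: x :: r] ++ R) :=
    h.replace (A := [[v], P]) hR
      (by simpa using List.perm_middle.trans (hPerm.cons v))
      (by
        have : l ≠ [] := by rintro rfl; simp at hl
        simpa using this)
      (by
        simp only [List.mem_cons, List.not_mem_nil, or_false, forall_eq_or_imp, forall_eq]
        exact ⟨hc'.1, List.isChain_cons_cons.2 ⟨hvx, hc'.2.1⟩⟩)
  have := h.singletonCount_le _ hcov (by rw [hR.length_eq]; simp)
  have hPl := hPerm.length_eq
  rw [List.length_append, List.length_cons] at hPl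
  rw [singletonCount, hR.countP_eq, singletonCount] at this
  have h1 : l.length ≠ 1 := by omega
  have h2 : P.length ≠ 1 := by omega
  simp [h1, h2] at this

/-- A neighbour of a one-vertex path of an optimal cover is the middle of a three-vertex path. -/
theorem IsOptimalCover.eq_triple_of_adj (h : IsOptimalCover G L) {P : List V} {v x : V}
    (hv : [v] ∈ L) (hP : P ∈ L) (hx : x ∈ P) (hvx : G.Adj v x) : ∃ a b, P = [a, x, b] := by
  have hne : [v] ≠ P := by
    rintro rfl
    rw [List.mem_singleton] at hx
    exact hvx.ne hx.symm
  have hend : ¬ IsEnd x P := fun hx => h.not_adj_of_isEnd hv hP hne ⟨[], Or.inl rfl⟩ hx hvx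
  obtain ⟨l, r, rfl⟩ := List.append_of_mem hx
  have hch := h.chain _ hP
  have hl : ¬ 2 ≤ l.length := fun hl => h.not_adj_middle hv hP hne (.refl _) hch hl hvx
  have hr : ¬ 2 ≤ r.length := fun hr => by
    refine h.not_adj_middle (l := r.reverse) (r := l.reverse) hv hP hne ?_ ?_ (by simpa) hvx
    · simpa using List.reverse_perm (l ++ x :: r)
    · simpa using (isChain_reverse_iff _).2 hch
  match l, r with
  | [], r => exact absurd ⟨r, Or.inl rfl⟩ hend
  | l, [] => exact absurd ⟨l, Or.inr rfl⟩ hend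
  | [a], [b] => exact ⟨a, b, rfl⟩
  | _ :: _ :: _, _ => simp at hl
  | _, _ :: _ :: _ => simp at hr

/-! ### Total forcing sets from list covers -/

/-- The first two vertices of each path of `L`, or the only vertex of a one-vertex path. -/
def starts (L : List (List V)) : List V := L.flatMap (List.take 2)

theorem mem_starts {v : V} : v ∈ starts L ↔ ∃ P ∈ L, v ∈ P.take 2 := List.mem_flatMap

theorem length_starts (L : List (List V)) :
    (starts L).length = (L.map fun P => min 2 P.length).sum := by
  simp [starts, List.length_flatMap]

theorem IsListCover.head_mem_starts {P : List V} (hP : P ∈ L) :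
    ∀ v ∈ P.head?, v ∈ starts L := by
  intro v hv
  refine mem_starts.2 ⟨P, hP, ?_⟩
  cases P <;> simp_all

theorem IsListCover.totalForcingNumber_le [Finite V] (hG : G.IsAcyclic) (h : IsListCover G L)
    {s : List V} (hs : ∀ P ∈ L, ∀ v ∈ P.head?, v ∈ s) (hadj : ∀ v ∈ s, ∃ w ∈ s, G.Adj v w) :
    totalForcingNumber G ≤ s.length :=
  totalForcingNumber_le_length ⟨h.isForcingSet hG hs, hadj⟩

theorem eq_singleton_or_exists_adj {P : List V} (hP : P.IsChain G.Adj) {v : V}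
    (hv : v ∈ P.take 2) : P = [v] ∨ ∃ w ∈ P.take 2, G.Adj v w := by
  match P with
  | [] => simp at hv
  | [a] => simp_all
  | a :: b :: l =>
    right
    have hab := (List.isChain_cons_cons.1 hP).1
    simp only [List.take_succ_cons, List.take_zero, List.mem_cons, List.not_mem_nil,
      or_false] at hv ⊢
    rcases hv with rfl | rfl
    · exact ⟨b, Or.inr rfl, hab⟩
    · exact ⟨a, Or.inl rfl, hab.symm⟩

theorem IsOptimalCover.totalForcingNumber_le_starts [Finite V] [Nontrivial V] (hG : G.IsTree)
    (h : IsOptimalCover G L) : totalForcingNumber G ≤ (starts L).length := by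
  refine h.totalForcingNumber_le hG.isAcyclic (fun P hP => IsListCover.head_mem_starts hP) ?_
  intro v hv
  obtain ⟨P, hP, hvP⟩ := mem_starts.1 hv
  rcases eq_singleton_or_exists_adj (h.chain P hP) hvP with rfl | ⟨w, hw, hvw⟩
  · obtain ⟨x, hx⟩ := hG.connected.preconnected.exists_adj_of_nontrivial v
    obtain ⟨Q, hQ, hxQ⟩ := h.exists_mem x
    obtain ⟨a, b, rfl⟩ := h.eq_triple_of_adj hP hQ hxQ hx
    exact ⟨x, mem_starts.2 ⟨_, hQ, by simp⟩, hx⟩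
  · exact ⟨w, mem_starts.2 ⟨P, hP, hw⟩, hvw⟩

/-- The sum of `|P| / 2 + 1` over the paths `P` of `L`. For a list cover with the minimum number of
paths, it is at most the sum of the matching number and the path cover number. -/
def budget (L : List (List V)) : ℕ := (L.map fun P => P.length / 2 + 1).sum

theorem IsListCover.budget_le [Finite V] (h : IsListCover G L) :
    budget L ≤ matchingNumber G + L.length := by
  have := h.sum_length_div_two_le
  simp only [budget, List.sum_map_add]
  simpa using this

theorem length_starts_le_budget (L : List (List V)) : (starts L).length ≤ budget L := by
  rw [length_starts, budget]
  exact List.sum_le_sum fun P _ => by omega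

theorem length_starts_lt_budget {P : List V} (hP : P ∈ L) (hlen : 4 ≤ P.length) :
    (starts L).length < budget L := by
  rw [length_starts, budget]
  exact List.sum_lt_sum _ _ (fun P _ => by omega) ⟨P, hP, by omega⟩

theorem budget_perm {L' : List (List V)} (h : L.Perm L') : budget L = budget L' :=
  (h.map _).sum_eq

/-! ### Covers of trees attaining the bound -/

/-- If the bound is attained, then a two-vertex path of an optimal cover has no neighbours outside. -/
theorem IsOptimalCover.not_adj_of_pair [Finite V] [Nontrivial V] (hG : G.IsTree)
    (h : IsOptimalCover G L) (hb : budget L ≤ totalForcingNumber G)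
    (hlen : ∀ P ∈ L, P.length ≤ 3) {P : List V} (hP : P ∈ L) {x y z : V}
    (hxy : P = [x, y] ∨ P = [y, x]) (hzy : z ≠ y) : ¬ G.Adj x z := by
  intro hxz
  obtain ⟨Q, hQ, hzQ⟩ := h.exists_mem z
  have hPQ : P ≠ Q := by
    rintro rfl
    have : z ≠ x := hxz.ne'
    rcases hxy with rfl | rfl <;> simp_all
  have hxP : IsEnd x P := by
    rcases hxy with rfl | rfl
    · exact ⟨[y], Or.inl rfl⟩
    · exact ⟨[y], Or.inr rfl⟩
  have hend : ¬ IsEnd z Q := fun hz => h.not_adj_of_isEnd hP hQ hPQ hxP hz hxz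
  obtain ⟨a, b, rfl⟩ : ∃ a b, Q = [a, z, b] := by
    obtain ⟨l, r, rfl⟩ := List.append_of_mem hzQ
    have hl := hlen _ hQ
    match l, r with
    | [], r => exact absurd ⟨r, Or.inl rfl⟩ hend
    | l, [] => exact absurd ⟨l, Or.inr rfl⟩ hend
    | [a], [b] => exact ⟨a, b, rfl⟩
    | _ :: _ :: l, _ :: r => simp at hl; omega
    | _ :: l, _ :: _ :: r => simp at hl; omega
  obtain ⟨R, hR⟩ := exists_perm_cons_cons hP hQ hPQ
  have hxyadj : G.Adj x y := by
    have := h.chain _ hP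
    rcases hxy with rfl | rfl
    · simpa using this
    · simpa [G.adj_comm] using this
  obtain ⟨haz, hzb⟩ : G.Adj a z ∧ G.Adj z b := by simpa using h.chain _ hQ
  -- The path `a z x y` starts with `a`, `z`, so that `y` need not be put into the total forcing set.
  have hcov : IsListCover G ([[b], [a, z, x, y]] ++ R) := by
    refine h.replace (A := [P, [a, z, b]]) hR ?_ (by simp) ?_
    · have h1 : P.Perm [x, y] := by
        rcases hxy with rfl | rfl
        · exact .refl _
        · exact .swap _ _ _
      simp only [List.flatten_cons, List.flatten_nil, List.append_nil]
      refine .trans ?_ (h1.symm.append_right _)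
      classical
      rw [List.perm_iff_count]
      intro u
      simp only [List.count_append, List.count_cons]
      omega
    · simp [haz, hxz.symm, hxyadj]
  have hle : totalForcingNumber G ≤ (b :: a :: z :: starts R).length := by
    refine hcov.totalForcingNumber_le hG.isAcyclic ?_ ?_
    · intro Q' hQ' v hv
      simp only [List.cons_append, List.nil_append, List.mem_cons] at hQ'
      rcases hQ' with rfl | rfl | hQ'
      · simp_all
      · simp_all
      · simp [IsListCover.head_mem_starts hQ' v hv]
    · intro v hv
      simp only [List.mem_cons] at hv
      rcases hv with rfl | rfl | rfl | hv
      · exact ⟨z, by simp, hzb.symm⟩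
      · exact ⟨z, by simp, haz⟩
      · exact ⟨a, by simp, haz.symm⟩
      · obtain ⟨Q', hQ', hvQ⟩ := mem_starts.1 hv
        have hQ'L : Q' ∈ L := hR.mem_iff.2 (by simp [hQ'])
        rcases eq_singleton_or_exists_adj (h.chain Q' hQ'L) hvQ with rfl | ⟨w, hw, hvw⟩
        · obtain ⟨t, ht⟩ := hG.connected.preconnected.exists_adj_of_nontrivial v
          obtain ⟨M, hM, htM⟩ := h.exists_mem t
          obtain ⟨a', b', rfl⟩ := h.eq_triple_of_adj hQ'L hM htM ht
          refine ⟨t, ?_, ht⟩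
          have hM' := hR.mem_iff.1 hM
          simp only [List.mem_cons] at hM'
          rcases hM' with hM' | hM' | hM'
          · rcases hxy with rfl | rfl <;> simp at hM'
          · simp_all
          · simp only [List.mem_cons]
            exact Or.inr (Or.inr (Or.inr (mem_starts.2 ⟨_, hM', by simp⟩)))
        · simp only [List.mem_cons]
          exact ⟨w, Or.inr (Or.inr (Or.inr (mem_starts.2 ⟨_, hQ', hw⟩))), hvw⟩
  have h2 := length_starts_le_budget R
  have h3 : P.length = 2 := by rcases hxy with rfl | rfl <;> rfl
  rw [budget_perm hR] at hb
  simp only [budget, List.map_cons, List.sum_cons, List.length_cons, List.length_nil, h3] at hb h2 hle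
  omega

theorem nonempty_iso_top_of_pair (hG : G.Connected) {x y : V} (hxy : G.Adj x y)
    (hx : ∀ z, G.Adj x z → z = y) (hy : ∀ z, G.Adj y z → z = x) :
    Nonempty (G ≃g (⊤ : SimpleGraph (Fin 2))) := by
  classical
  have hwalk : ∀ u v, G.Walk u v → u = x ∨ u = y → v = x ∨ v = y := by
    intro u v p
    induction p with
    | nil => exact id
    | cons huv _ ih =>
      rintro (rfl | rfl)
      · exact ih (Or.inr (hx _ huv))
      · exact ih (Or.inl (hy _ huv))
  have hV : ∀ v, v = x ∨ v = y := fun v => by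
    obtain ⟨p⟩ := hG.preconnected x v
    exact hwalk x v p (Or.inl rfl)
  refine ⟨⟨⟨fun v => if v = x then 0 else 1, fun i => if i = 0 then x else y, ?_, ?_⟩, ?_⟩⟩
  · intro v
    rcases hV v with rfl | rfl
    · simp
    · simp [hxy.ne']
  · intro i
    fin_cases i
    · simp
    · simp [hxy.ne']
  · intro u v
    rcases hV u with rfl | rfl <;> rcases hV v with rfl | rfl <;>
      simp [hxy, hxy.symm, hxy.ne']

/-- `l` is a leaf whose only neighbour is `c`. -/
def LeafAt (G : SimpleGraph V) (l c : V) : Prop := ∀ w, G.Adj l w ↔ w = c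

/-- `C` meets every edge, and every vertex of `C` is adjacent to at least two leaves. For a tree with
at least two vertices, this describes the members of the family other than `K₂` without reference
to the smaller tree: `C` is the set of vertices to which pendant edges are attached. -/
structure IsPendantCover (G : SimpleGraph V) (C : Set V) : Prop where
  mem_or_mem : ∀ ⦃u v⦄, G.Adj u v → u ∈ C ∨ v ∈ C
  exists_leaves : ∀ c ∈ C, ∃ l₁ l₂, l₁ ≠ l₂ ∧ LeafAt G l₁ c ∧ LeafAt G l₂ c

/-- The middles of the three-vertex paths of `L`. -/
def centers (L : List (List V)) : Set V := {c | ∃ a b, [a, c, b] ∈ L}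

/-- The vertices outside `centers L` are ends of their paths, so an edge between two of them would
either merge two paths or close a triangle. -/
theorem IsOptimalCover.mem_centers_or_mem_centers (hG : G.IsAcyclic) (h : IsOptimalCover G L)
    (hshape : ∀ P ∈ L, (∃ v, P = [v]) ∨ ∃ a c b, P = [a, c, b]) ⦃u v : V⦄ (huv : G.Adj u v) :
    u ∈ centers L ∨ v ∈ centers L := by
  have hend : ∀ w, w ∉ centers L → ∀ P ∈ L, w ∈ P → IsEnd w P := by
    intro w hw P hP hwP
    rcases hshape P hP with ⟨v, rfl⟩ | ⟨a, c, b, rfl⟩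
    · rw [List.mem_singleton] at hwP
      exact ⟨[], Or.inl (by rw [hwP])⟩
    · simp only [List.mem_cons, List.not_mem_nil, or_false] at hwP
      rcases hwP with rfl | rfl | rfl
      · exact ⟨[c, b], Or.inl rfl⟩
      · exact absurd ⟨a, b, hP⟩ hw
      · exact ⟨[a, c], Or.inr rfl⟩
  by_contra! hcon
  obtain ⟨P, hP, huP⟩ := h.exists_mem u
  obtain ⟨Q, hQ, hvQ⟩ := h.exists_mem v
  by_cases hPQ : P = Q
  · subst hPQ
    rcases hshape P hP with ⟨w, rfl⟩ | ⟨a, c, b, rfl⟩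
    · simp only [List.mem_singleton] at huP hvQ
      exact huv.ne (huP.trans hvQ.symm)
    · obtain ⟨hac, hcb⟩ : G.Adj a c ∧ G.Adj c b := by simpa using h.chain _ hP
      have hc : c ∈ centers L := ⟨a, b, hP⟩
      have htri : ∀ {p q : V}, G.Adj p c → G.Adj q c → ¬ G.Adj p q := by
        intro p q hp hq hpq
        classical
        exact hG.cliqueFree le_rfl {p, c, q} (is3Clique_triple_iff.2 ⟨hp, hpq, hq.symm⟩)
      have hne : ∀ w, w ∉ centers L → w ∈ [a, c, b] → G.Adj w c := by
        intro w hw hwP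
        simp only [List.mem_cons, List.not_mem_nil, or_false] at hwP
        rcases hwP with rfl | rfl | rfl
        · exact hac
        · exact absurd hc hw
        · exact hcb.symm
      exact htri (hne u hcon.1 huP) (hne v hcon.2 hvQ) huv
  · exact h.not_adj_of_isEnd hP hQ hPQ (hend u hcon.1 P hP huP) (hend v hcon.2 Q hQ hvQ) huv

/-- Suppose that all leaves at `c` are equal to `b`. Then `a` and the first two vertices of the paths
in `R` form a total forcing set: a vertex of it outside `C` has a neighbour in `C` other than `c`,
as it would otherwise be a leaf at `c`. -/
theorem IsListCover.totalForcingNumber_lt_budget [Finite V] [Nontrivial V] (hG : G.IsTree)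
    {R : List (List V)} {C : Set V} {a c b : V} (h : IsListCover G ([a, c, b] :: R))
    (hC : ∀ ⦃u v⦄, G.Adj u v → u ∈ C ∨ v ∈ C)
    (hCR : ∀ d ∈ C, d ≠ c → ∃ a' b', [a', d, b'] ∈ R) (hleaf : ∀ l, LeafAt G l c → l = b) :
    totalForcingNumber G < budget ([a, c, b] :: R) := by
  have hle : totalForcingNumber G ≤ (a :: starts R).length := by
    refine h.totalForcingNumber_le hG.isAcyclic ?_ ?_
    · intro Q hQ v hv
      rcases List.mem_cons.1 hQ with rfl | hQ
      · simp_all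
      · simp [IsListCover.head_mem_starts hQ v hv]
    · have hnd := h.nodup
      simp only [List.flatten_cons, List.cons_append, List.nil_append, List.nodup_cons,
        List.mem_cons, not_or] at hnd
      have hR : ∀ v ∈ starts R, v ∈ R.flatten := by
        intro v hv
        obtain ⟨P, hP, hvP⟩ := mem_starts.1 hv
        exact List.mem_flatten.2 ⟨P, hP, List.mem_of_mem_take hvP⟩
      have hmem : ∀ d ∈ C, d ≠ c → d ∈ a :: starts R := by
        intro d hd hdc
        obtain ⟨a', b', hdR⟩ := hCR d hd hdc
        exact List.mem_cons_of_mem _ (mem_starts.2 ⟨_, hdR, by simp⟩)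
      intro v hv
      have hvc : v ≠ c ∧ v ≠ b := by
        rcases List.mem_cons.1 hv with rfl | hv
        · exact ⟨hnd.1.1, hnd.1.2.1⟩
        · constructor <;> rintro rfl
          · exact hnd.2.1.2 (hR _ hv)
          · exact hnd.2.2.1 (hR _ hv)
      by_cases hvC : v ∈ C
      · obtain ⟨a', b', hvR⟩ := hCR v hvC hvc.1
        have := h.chain _ (List.mem_cons_of_mem _ hvR)
        simp only [List.isChain_cons_cons] at this
        exact ⟨a', List.mem_cons_of_mem _ (mem_starts.2 ⟨_, hvR, by simp⟩), this.1.symm⟩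
      · by_contra! hno
        have hcn : ∀ w, G.Adj v w → w = c := by
          intro w hw
          by_contra hwc
          exact hno w (hmem w ((hC hw).resolve_left hvC) hwc) hw
        obtain ⟨w, hw⟩ := hG.connected.preconnected.exists_adj_of_nontrivial v
        have := hcn w hw
        subst this
        exact hvc.2 (hleaf v fun z => ⟨hcn z, fun hz => hz ▸ hw⟩)
  have h2 := length_starts_le_budget R
  simp only [budget, List.map_cons, List.sum_cons, List.length_cons, List.length_nil] at h2 hle ⊢
  omega

theorem IsOptimalCover.exists_leaves [Finite V] [Nontrivial V] (hG : G.IsTree)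
    (h : IsOptimalCover G L) (hb : budget L ≤ totalForcingNumber G)
    (hshape : ∀ P ∈ L, (∃ v, P = [v]) ∨ ∃ a c b, P = [a, c, b]) {c : V} (hc : c ∈ centers L) :
    ∃ l₁ l₂, l₁ ≠ l₂ ∧ LeafAt G l₁ c ∧ LeafAt G l₂ c := by
  by_contra! hcon
  have huniq : ∀ l₁ l₂, LeafAt G l₁ c → LeafAt G l₂ c → l₁ = l₂ := fun l₁ l₂ h1 h2 => by
    by_contra hne
    exact hcon l₁ l₂ hne h1 h2
  have hCov := h.mem_centers_or_mem_centers hG.isAcyclic hshape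
  obtain ⟨a, b, hP⟩ := hc
  obtain ⟨hac, hcb⟩ : G.Adj a c ∧ G.Adj c b := by simpa using h.chain _ hP
  have hother : ∀ d ∈ centers L, d ≠ c → ∃ a' b', [a', d, b'] ∈ L ∧ [a', d, b'] ≠ [a, c, b] := by
    rintro d ⟨a', b', hd⟩ hdc
    exact ⟨a', b', hd, by simp [hdc]⟩
  obtain ⟨R, hR⟩ := exists_perm_cons hP
  have hCR : ∀ d ∈ centers L, d ≠ c → ∃ a' b', [a', d, b'] ∈ R := by
    intro d hd hdc
    obtain ⟨a', b', hd, hne⟩ := hother d hd hdc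
    exact ⟨a', b', (List.mem_cons.1 (hR.mem_iff.1 hd)).resolve_left hne⟩
  have key : ∀ a' b', IsListCover G ([a', c, b'] :: R) → ¬ ∀ l, LeafAt G l c → l = b' := by
    intro a' b' hcov hl
    refine absurd (hcov.totalForcingNumber_lt_budget hG hCov hCR hl) (not_lt.2 ?_)
    rw [budget_perm hR] at hb
    simpa [budget] using hb
  have hcov : IsListCover G ([a, c, b] :: R) := h.toIsListCover.perm hR
  have hcov' : IsListCover G ([b, c, a] :: R) :=
    h.replace (A := [[a, c, b]]) (A' := [[b, c, a]]) hR
      (by simpa using List.reverse_perm [a, c, b]) (by simp) (by simp [hcb.symm, hac.symm])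
  obtain ⟨v, hv, hvb⟩ : ∃ v, LeafAt G v c ∧ v ≠ b := by simpa using key a b hcov
  have hva : v ≠ a := by
    rintro rfl
    exact key b v hcov' fun l hl => huniq l v hl hv
  have hvc : G.Adj v c := (hv c).2 rfl
  obtain ⟨Q, hQ, hvQ⟩ := h.exists_mem v
  have hQv : Q = [v] := by
    rcases hshape Q hQ with ⟨w, rfl⟩ | ⟨a₁, c₁, b₁, rfl⟩
    · rw [List.mem_singleton.1 hvQ]
    · exfalso
      obtain ⟨h1, h2⟩ : G.Adj a₁ c₁ ∧ G.Adj c₁ b₁ := by simpa using h.chain _ hQ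
      have hnd := (List.nodup_flatten.1 h.nodup).1 _ hQ
      have hcQ : c ∈ [a₁, c₁, b₁] := by
        simp only [List.mem_cons, List.not_mem_nil, or_false] at hvQ
        rcases hvQ with rfl | rfl | rfl
        · simp [(hv _).1 h1]
        · simp [(hv _).1 h2]
        · simp [(hv _).1 h2.symm]
      have := h.eq_of_mem hQ hP hcQ (by simp)
      rw [this] at hvQ
      simp [hva, hvb, hvc.ne] at hvQ
  subst hQv
  have hne : [a, c, b] ≠ [v] := by simp
  -- Exchange the end `b` of the path through `c` with the leaf `v`.
  obtain ⟨R', hR'⟩ := exists_perm_cons_cons hP hQ hne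
  have hswap : IsListCover G ([a, c, v] :: [b] :: R') := by
    refine h.replace (A := [[a, c, b], [v]]) (A' := [[a, c, v], [b]]) hR' ?_ (by simp)
      (by simp [hac, hvc.symm])
    simpa using ((List.Perm.swap b v []).cons c).cons a
  refine absurd (hswap.totalForcingNumber_lt_budget hG hCov ?_ fun l hl => huniq l v hl hv)
    (not_lt.2 ?_)
  · intro d hd hdc
    obtain ⟨a', b', hd, hne⟩ := hother d hd hdc
    refine ⟨a', b', ?_⟩
    have := (List.mem_cons.1 (hR'.mem_iff.1 hd)).resolve_left hne
    simp only [List.mem_cons] at this ⊢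
    exact Or.inr (this.resolve_left (by simp))
  · rw [budget_perm hR'] at hb
    simpa [budget] using hb

theorem iso_top_or_exists_isPendantCover [Finite V] [Nontrivial V] (hG : G.IsTree)
    (h : IsOptimalCover G L) (hb : budget L ≤ totalForcingNumber G) :
    Nonempty (G ≃g (⊤ : SimpleGraph (Fin 2))) ∨ ∃ C, IsPendantCover G C := by
  have hlen : ∀ P ∈ L, P.length ≤ 3 := by
    intro P hP
    by_contra! hlt
    exact absurd ((length_starts_lt_budget hP hlt).trans_le
      (hb.trans (h.totalForcingNumber_le_starts hG))) (lt_irrefl _)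
  by_cases hpair : ∃ x y, [x, y] ∈ L
  · left
    obtain ⟨x, y, hP⟩ := hpair
    refine nonempty_iso_top_of_pair (x := x) (y := y) hG.connected (by simpa using h.chain _ hP)
      (fun z hz => ?_) (fun z hz => ?_)
    · by_contra hne
      exact h.not_adj_of_pair hG hb hlen hP (Or.inl rfl) hne hz
    · by_contra hne
      exact h.not_adj_of_pair hG hb hlen hP (Or.inr rfl) hne hz
  · right
    have hshape : ∀ P ∈ L, (∃ v, P = [v]) ∨ ∃ a c b, P = [a, c, b] := by
      intro P hP
      have h1 := hlen P hP
      have h2 := h.ne_nil P hP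
      match P with
      | [] => exact absurd rfl h2
      | [v] => exact Or.inl ⟨v, rfl⟩
      | [x, y] => exact absurd ⟨x, y, hP⟩ hpair
      | [a, c, b] => exact Or.inr ⟨a, c, b, rfl⟩
      | _ :: _ :: _ :: _ :: _ =>
        simp only [List.length_cons] at h1
        omega
    exact ⟨centers L, h.mem_centers_or_mem_centers hG.isAcyclic hshape,
      fun c hc => h.exists_leaves hG hb hshape hc⟩

/-! ### Pendant covers and the family -/

theorem LeafAt.isLeaf {l c : V} (h : LeafAt G l c) : IsLeaf G l :=
  ⟨c, (h c).2 rfl, fun w hw => (h w).1 hw⟩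

theorem IsLeaf.leafAt {l c : V} (h : IsLeaf G l) (hc : G.Adj l c) : LeafAt G l c :=
  fun _ => ⟨fun hw => h.unique hw hc, fun hw => hw ▸ hc⟩

theorem LeafAt.adj {l c : V} (h : LeafAt G l c) : G.Adj l c := (h c).2 rfl

theorem not_isLeaf_of_leafAt {l₁ l₂ c : V} (hne : l₁ ≠ l₂) (h₁ : LeafAt G l₁ c)
    (h₂ : LeafAt G l₂ c) : ¬ IsLeaf G c :=
  fun h => hne (h.unique h₁.adj.symm h₂.adj.symm)

theorem IsPendantCover.not_isLeaf {C : Set V} (h : IsPendantCover G C) {c : V} (hc : c ∈ C) :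
    ¬ IsLeaf G c := by
  obtain ⟨l₁, l₂, hne, h₁, h₂⟩ := h.exists_leaves c hc
  exact not_isLeaf_of_leafAt hne h₁ h₂

theorem exists_fin_range_eq [Finite V] (s : Set V) :
    ∃ (n : ℕ) (f : Fin n → V), Function.Injective f ∧ Set.range f = s := by
  refine ⟨Nat.card s, fun i => ((Finite.equivFin s).symm i : V),
    Subtype.val_injective.comp (Equiv.injective _), ?_⟩
  ext v
  constructor
  · rintro ⟨i, rfl⟩
    exact Subtype.property _
  · exact fun hv => ⟨Finite.equivFin s ⟨v, hv⟩,
      congrArg Subtype.val ((Finite.equivFin s).symm_apply_apply ⟨v, hv⟩)⟩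

/-- Deleting all leaves from a tree in which no two leaves are adjacent leaves a tree. The map `g`
enumerates the vertices that are kept; connectedness is seen by retracting each leaf to its
neighbour. -/
theorem isTree_comap_nonleaves [Nontrivial V] (hG : G.IsTree)
    (hnn : ∀ u v, G.Adj u v → IsLeaf G u → ¬ IsLeaf G v) {W : Type*} {g : W → V}
    (hg : Function.Injective g) (hr : ∀ v, v ∈ Set.range g ↔ ¬ IsLeaf G v) :
    (G.comap g).IsTree := by
  -- The retraction keeps each remaining vertex and sends each leaf to its neighbour.
  have hret : ∀ v, ∃ i, (¬ IsLeaf G v → g i = v) ∧ (IsLeaf G v → G.Adj v (g i)) := by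
    intro v
    by_cases hv : IsLeaf G v
    · obtain ⟨w, hw⟩ := hG.connected.preconnected.exists_adj_of_nontrivial v
      obtain ⟨i, rfl⟩ := (hr w).2 (hnn v w hw hv)
      exact ⟨i, fun h => absurd hv h, fun _ => hw⟩
    · obtain ⟨i, hi⟩ := (hr v).2 hv
      exact ⟨i, fun _ => hi, fun h => absurd h hv⟩
  choose r hr1 hr2 using hret
  have hstep : ∀ u v, G.Adj u v → (G.comap g).Reachable (r u) (r v) := by
    intro u v huv
    by_cases hu : IsLeaf G u
    · have h1 := hr1 v (hnn u v huv hu)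
      rw [hg (h1.trans (hu.unique huv (hr2 u hu)))]
    · by_cases hv : IsLeaf G v
      · have h1 := hr1 u hu
        rw [hg (h1.trans (hv.unique huv.symm (hr2 v hv)))]
      · refine Adj.reachable ?_
        rw [comap_adj, hr1 u hu, hr1 v hv]
        exact huv
  have hwalk : ∀ u v, G.Walk u v → (G.comap g).Reachable (r u) (r v) := by
    intro u v p
    induction p with
    | nil => exact .refl _
    | cons h _ ih => exact (hstep _ _ h).trans ih
  have hrg : ∀ i, r (g i) = i := fun i => hg (hr1 _ ((hr _).1 ⟨i, rfl⟩))
  obtain ⟨v⟩ := hG.connected.nonempty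
  have : Nonempty W := ⟨r v⟩
  refine ⟨⟨fun i j => ?_⟩, hG.isAcyclic.comap (Hom.comap g G) hg⟩
  obtain ⟨p⟩ := hG.connected.preconnected (g i) (g j)
  simpa [hrg] using hwalk _ _ p

theorem IsPendantCover.inFamily [Finite V] [Nontrivial V] (hG : G.IsTree) {C : Set V}
    (h : IsPendantCover G C) : InFamily G := by
  have hnC : ∀ u v, G.Adj u v → u ∉ C → v ∈ C := fun u v huv hu =>
    (h.mem_or_mem huv).resolve_left hu
  have hleafC : ∀ u, IsLeaf G u → u ∉ C := fun u hu huC => h.not_isLeaf huC hu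
  have hnn : ∀ u v, G.Adj u v → IsLeaf G u → ¬ IsLeaf G v := fun u v huv hu =>
    h.not_isLeaf (hnC u v huv (hleafC u hu))
  obtain ⟨m, g, hg, hgr⟩ := exists_fin_range_eq {v | ¬ IsLeaf G v}
  have hr : ∀ v, v ∈ Set.range g ↔ ¬ IsLeaf G v := fun v => by rw [hgr]; rfl
  have hgn : ∀ i, ¬ IsLeaf G (g i) := fun i => (hr _).1 ⟨i, rfl⟩
  choose k f hf hfr using fun i => exists_fin_range_eq {l | LeafAt G l (g i)}
  have hfl : ∀ i j, LeafAt G (f i j) (g i) := fun i j => by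
    have : f i j ∈ Set.range (f i) := ⟨j, rfl⟩
    rw [hfr] at this
    exact this
  refine Or.inr ⟨m, G.comap g, g ⁻¹' C, k, isTree_comap_nonleaves hG hnn hg hr,
    Or.inr ⟨?_, ?_⟩, ?_, ?_, ?_⟩
  · intro i hi j hj _ hij
    exact hj (hnC _ _ hij hi)
  · rintro i hi ⟨j, hj, hju⟩
    obtain ⟨v, hv⟩ := hG.connected.preconnected.exists_adj_of_nontrivial (g i)
    refine hgn i ⟨g j, hj, fun w hw => ?_⟩
    obtain ⟨j', rfl⟩ := (hr w).2 (h.not_isLeaf (hnC _ _ hw hi))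
    rw [hju j' hw]
  · intro i hi
    obtain ⟨l₁, l₂, hne, h₁, h₂⟩ := h.exists_leaves _ hi
    obtain ⟨a, rfl⟩ : l₁ ∈ Set.range (f i) := by rw [hfr]; exact h₁
    obtain ⟨b, rfl⟩ : l₂ ∈ Set.range (f i) := by rw [hfr]; exact h₂
    have : a ≠ b := fun hab => hne (congrArg _ hab)
    have := Fin.val_ne_of_ne this
    omega
  · intro i hi
    by_contra hk
    have hl := hfl i ⟨0, Nat.pos_of_ne_zero hk⟩
    exact hleafC _ hl.isLeaf ((h.mem_or_mem hl.adj).resolve_right hi)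
  · let φ : Fin m ⊕ (Σ i, Fin (k i)) → V := Sum.elim g fun x => f x.1 x.2
    have hφ : Function.Bijective φ := by
      constructor
      · rintro (i | ⟨i, a⟩) (j | ⟨j, b⟩) hij
        · exact congrArg _ (hg hij)
        · change g i = f j b at hij
          exact absurd (hij ▸ (hfl j b).isLeaf) (hgn i)
        · change f i a = g j at hij
          exact absurd (hij ▸ (hfl i a).isLeaf) (hgn j)
        · change f i a = f j b at hij
          have hgij : g i = g j := (hfl j b _).1 (hij ▸ (hfl i a).adj)
          obtain rfl := hg hgij
          rw [hf i hij]
      · intro v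
        by_cases hv : IsLeaf G v
        · obtain ⟨w, hw⟩ := hv.exists
          obtain ⟨i, rfl⟩ := (hr w).2 (hnn v w hw hv)
          obtain ⟨a, rfl⟩ : v ∈ Set.range (f i) := by rw [hfr]; exact hv.leafAt hw
          exact ⟨Sum.inr ⟨i, a⟩, rfl⟩
        · obtain ⟨i, rfl⟩ := (hr v).2 hv
          exact ⟨Sum.inl i, rfl⟩
    have hleaf : ∀ i a j, G.Adj (f i a) (g j) ↔ i = j := fun i a j =>
      (hfl i a (g j)).trans ⟨fun h => (hg h).symm, fun h => congrArg g h.symm⟩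
    refine ⟨(RelIso.mk (Equiv.ofBijective φ hφ) ?_ : attachPendant (G.comap g) k ≃g G).symm⟩
    rintro (i | ⟨i, a⟩) (j | ⟨j, b⟩)
    · exact Iff.rfl
    · exact (G.adj_comm _ _).trans (hleaf j b i)
    · exact hleaf i a j
    · exact iff_of_false (fun hadj => hnn _ _ hadj (hfl i a).isLeaf (hfl j b).isLeaf) id

theorem exists_isPendantCover_of_iso {W : Type*} {H : SimpleGraph W} {A : Set W} {k : W → ℕ}
    (hA : A = Set.univ ∨ H.IsIndepSet Aᶜ) (h2 : ∀ w ∈ A, 2 ≤ k w) (h0 : ∀ w ∉ A, k w = 0)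
    (φ : G ≃g attachPendant H k) : ∃ C, IsPendantCover G C := by
  have hmem : ∀ x : Σ w, Fin (k w), x.1 ∈ A := by
    rintro ⟨w, i⟩
    by_contra hw
    have hi := i.isLt
    have hk := h0 w hw
    omega
  refine ⟨{v | ∃ w ∈ A, φ v = Sum.inl w}, fun u v huv => ?_, ?_⟩
  · have huv' := φ.map_adj_iff.2 huv
    simp only [Set.mem_ofPred_eq]
    rcases hu : φ u with a | x <;> rcases hv : φ v with b | y <;> rw [hu, hv] at huv'
    · have hab : H.Adj a b := huv'
      have : a ∈ A ∨ b ∈ A := by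
        rcases hA with rfl | hA
        · simp
        · by_contra! hcon
          exact hA hcon.1 hcon.2 hab.ne hab
      simpa using this
    · have hya : y.1 = a := huv'
      exact Or.inl ⟨a, hya ▸ hmem y, rfl⟩
    · have hxb : x.1 = b := huv'
      exact Or.inr ⟨b, hxb ▸ hmem x, rfl⟩
    · exact absurd huv' id
  · rintro c ⟨w, hw, hc⟩
    have hleaf : ∀ i : Fin (k w), LeafAt G (φ.symm (Sum.inr ⟨w, i⟩)) c := by
      intro i z
      rw [← φ.map_adj_iff, RelIso.apply_symm_apply, ← φ.injective.eq_iff, hc]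
      rcases φ z with a | x
      · change w = a ↔ _
        rw [Sum.inl.injEq, eq_comm]
      · exact iff_of_false id (by simp)
    have hk := h2 w hw
    refine ⟨_, _, ?_, hleaf ⟨0, by omega⟩, hleaf ⟨1, by omega⟩⟩
    simp

/-! ### Bounds for trees in the family -/

/-- Two leaves with a common neighbour are never coloured if neither belongs to `S`. -/
theorem not_colored_of_leafAt {S : Set V} {l₁ l₂ c : V} (hne : l₁ ≠ l₂) (h₁ : LeafAt G l₁ c)
    (h₂ : LeafAt G l₂ c) (hS₁ : l₁ ∉ S) (hS₂ : l₂ ∉ S) {v : V} (hv : Colored G S v) :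
    v ≠ l₁ ∧ v ≠ l₂ := by
  induction hv with
  | initial v hv => constructor <;> rintro rfl <;> contradiction
  | force u v _ huv _ _ ih =>
    constructor
    · rintro rfl
      obtain rfl := (h₁ u).1 huv.symm
      exact (ih l₂ h₂.adj.symm hne.symm).2 rfl
    · rintro rfl
      obtain rfl := (h₂ u).1 huv.symm
      exact (ih l₁ h₁.adj.symm hne).1 rfl

theorem IsPendantCover.subset_of_isTotalForcingSet {C S : Set V} (h : IsPendantCover G C)
    (hS : IsTotalForcingSet G S) : C ⊆ S := by
  intro c hc
  obtain ⟨l₁, l₂, hne, h₁, h₂⟩ := h.exists_leaves c hc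
  have hl : ∀ l, LeafAt G l c → l ∈ S → c ∈ S := by
    intro l hl hlS
    obtain ⟨w, hw, hlw⟩ := hS.2 l hlS
    exact (hl w).1 hlw ▸ hw
  by_contra hcS
  exact (not_colored_of_leafAt hne h₁ h₂ (fun hs => hcS (hl l₁ h₁ hs))
    (fun hs => hcS (hl l₂ h₂ hs)) (hS.1 l₁)).1 rfl

/-- If the vertex cover `C` is contained in the forcing set `S`, then all vertices outside `S` are forced
by distinct vertices of `C`. -/
theorem card_le_card_add_card [Fintype V] {S C : Finset V} (hS : IsForcingSet G (S : Set V))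
    (hCS : C ⊆ S) (hC : ∀ u v, G.Adj u v → u ∈ C ∨ v ∈ C) : Fintype.card V ≤ S.card + C.card := by
  classical
  -- Take a maximal set `X ⊇ S` such that `X \ S` has at most as many elements as
  -- there are vertices of `C` with all their neighbours in `X`.
  let full (X : Finset V) : Finset V := C.filter fun u => ∀ w, G.Adj u w → w ∈ X
  obtain ⟨X, hX⟩ := (Set.toFinite {X : Finset V | S ⊆ X ∧
    X.card ≤ S.card + (full X).card}).exists_maximal ⟨S, subset_rfl, by omega⟩
  have hXmem : S ⊆ X ∧ X.card ≤ S.card + (full X).card := hX.prop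
  have hall : ∀ v, Colored G S v → v ∈ X := by
    intro v hv
    induction hv with
    | initial v hv => exact hXmem.1 hv
    | force u v _ huv _ hu ih =>
      by_contra hvX
      have huC : u ∈ C := (hC u v huv).resolve_right fun hvC => hvX (hXmem.1 (hCS hvC))
      have hu' : u ∉ full X := fun h => hvX ((Finset.mem_filter.1 h).2 v huv)
      have hsub : insert u (full X) ⊆ full (insert v X) := by
        intro x hx
        rcases Finset.mem_insert.1 hx with rfl | hx
        · refine Finset.mem_filter.2 ⟨huC, fun w hw => ?_⟩
          by_cases hwv : w = v
          · simp [hwv]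
          · exact Finset.mem_insert_of_mem (ih w hw hwv)
        · obtain ⟨h1, h2⟩ := Finset.mem_filter.1 hx
          exact Finset.mem_filter.2 ⟨h1, fun w hw => Finset.mem_insert_of_mem (h2 w hw)⟩
      have hcard := Finset.card_le_card hsub
      rw [Finset.card_insert_of_notMem hu'] at hcard
      have hle : insert v X ≤ X := hX.2 ⟨hXmem.1.trans (Finset.subset_insert _ _), by
        rw [Finset.card_insert_of_notMem hvX]
        omega⟩ (Finset.subset_insert _ _)
      exact hvX (hle (Finset.mem_insert_self _ _))
  have hXu : X = Finset.univ := Finset.eq_univ_of_forall fun v => hall v (hS v)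
  have h1 := hXmem.2
  rw [hXu, Finset.card_univ] at h1
  have : (full Finset.univ).card ≤ C.card := Finset.card_filter_le _ _
  omega

theorem matchingNumber_le_card {C : Finset V} (hC : ∀ u v, G.Adj u v → u ∈ C ∨ v ∈ C) :
    matchingNumber G ≤ C.card := by
  unfold matchingNumber
  refine csSup_le' ?_
  rintro _ ⟨M, hM, rfl⟩
  have hex : ∀ e : Sym2 V, ∃ c, e ∈ M.edgeSet → c ∈ C ∧ c ∈ e := by
    intro e
    by_cases he : e ∈ M.edgeSet
    · induction e with | _ u v =>
      rcases hC u v (M.adj_sub he) with h | h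
      · exact ⟨u, fun _ => ⟨h, by simp⟩⟩
      · exact ⟨v, fun _ => ⟨h, by simp⟩⟩
    · by_cases hV : Nonempty V
      · exact ⟨hV.some, fun h => absurd h he⟩
      · induction e with | _ u v => exact absurd ⟨u⟩ hV
  choose f hf using hex
  rw [← Set.ncard_coe_finset]
  refine Set.ncard_le_ncard_of_injOn f (fun e he => (hf e he).1) (fun e he e' he' hee' => ?_)
    C.finite_toSet
  have h1 := (hf e he).2
  have h2 := (hf e' he').2
  rw [← hee'] at h2
  obtain ⟨v, hv⟩ := h1
  obtain ⟨w, hw⟩ := h2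
  rw [hv] at he
  rw [hw] at he'
  rw [hv, hw, hM.eq_of_adj_left (Subgraph.mem_edgeSet.1 he) (Subgraph.mem_edgeSet.1 he')]

/-- A path cover that consists of one path leaf-`c`-leaf for each `c ∈ C` and of single vertices. With
`C = ∅` it shows that path covers exist. -/
theorem exists_isPathCover [Fintype V] {C : Finset V}
    (hC : ∀ c ∈ C, ∃ l₁ l₂, l₁ ≠ l₂ ∧ LeafAt G l₁ c ∧ LeafAt G l₂ c) :
    ∃ K : Finset G.Subgraph, IsPathCover G K ∧ K.card + 2 * C.card ≤ Fintype.card V := by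
  classical
  have hex : ∀ c, ∃ l₁ l₂, c ∈ C → l₁ ≠ l₂ ∧ LeafAt G l₁ c ∧ LeafAt G l₂ c := fun c => by
    by_cases hc : c ∈ C
    · obtain ⟨l₁, l₂, h⟩ := hC c hc
      exact ⟨l₁, l₂, fun _ => h⟩
    · exact ⟨c, c, fun h => absurd h hc⟩
  choose l₁ l₂ hl using hex
  have hinj : ∀ {l c d}, LeafAt G l c → LeafAt G l d → c = d := fun h h' => (h' _).1 h.adj
  have hPex : ∀ v, ∃ P : G.Subgraph, IsPathSubgraph P ∧
      ∀ x, x ∈ P.verts ↔ x = v ∨ v ∈ C ∧ (x = l₁ v ∨ x = l₂ v) := by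
    intro v
    by_cases hv : v ∈ C
    · obtain ⟨hne, h1, h2⟩ := hl v hv
      refine ⟨_, ⟨l₁ v, l₂ v, .cons h1.adj (.cons h2.adj.symm .nil), ?_, rfl⟩, fun x => ?_⟩
      · simp [h1.adj.ne, h2.adj.ne', hne]
      · rw [Walk.mem_verts_toSubgraph]
        simp only [Walk.support_cons, Walk.support_nil, List.mem_cons, List.not_mem_nil, or_false,
          hv, true_and]
        tauto
    · exact ⟨_, ⟨v, v, .nil, by simp, rfl⟩, fun x => by simp [hv]⟩
  choose P hP hPv using hPex
  -- The paths are indexed by `D`: those through `C` by their middles, the others by their vertices.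
  set D : Finset V := Finset.univ \ (C.image l₁ ∪ C.image l₂) with hD
  have hmemD : ∀ v, v ∈ D ↔ ∀ c ∈ C, v ≠ l₁ c ∧ v ≠ l₂ c := by
    intro v
    simp only [hD, Finset.mem_sdiff, Finset.mem_univ, Finset.mem_union, Finset.mem_image, true_and,
      not_or, not_exists, not_and, ne_eq]
    constructor
    · exact fun h c hc => ⟨fun he => h.1 c hc he.symm, fun he => h.2 c hc he.symm⟩
    · exact fun h => ⟨fun c hc he => (h c hc).1 he.symm, fun c hc he => (h c hc).2 he.symm⟩
  have hCD : ∀ c ∈ C, c ∈ D := by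
    intro c hc
    obtain ⟨hne, h1, h2⟩ := hl c hc
    have hnl := not_isLeaf_of_leafAt hne h1 h2
    rw [hmemD]
    intro d hd
    obtain ⟨-, h1', h2'⟩ := hl d hd
    exact ⟨fun h => hnl (h ▸ h1'.isLeaf), fun h => hnl (h ▸ h2'.isLeaf)⟩
  refine ⟨D.image P, ⟨?_, fun v => ?_⟩, ?_⟩
  · simp only [Finset.mem_image]
    rintro _ ⟨v, -, rfl⟩
    exact hP v
  · by_cases hv : v ∈ D
    · refine ⟨P v, ⟨Finset.mem_image_of_mem _ hv, (hPv v v).2 (Or.inl rfl)⟩, ?_⟩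
      rintro Q ⟨hQ, hvQ⟩
      obtain ⟨d, hd, rfl⟩ := Finset.mem_image.1 hQ
      rcases (hPv d v).1 hvQ with rfl | ⟨hdC, h⟩
      · rfl
      · have := (hmemD v).1 hv d hdC
        tauto
    · obtain ⟨c, hc, hvc⟩ : ∃ c ∈ C, v = l₁ c ∨ v = l₂ c := by
        rw [hmemD] at hv
        push Not at hv
        obtain ⟨c, hc, h⟩ := hv
        exact ⟨c, hc, by tauto⟩
      have hleaf : ∀ d ∈ C, v = l₁ d ∨ v = l₂ d → LeafAt G v d := by
        rintro d hd (h | h)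
        · exact h ▸ (hl d hd).2.1
        · exact h ▸ (hl d hd).2.2
      refine ⟨P c, ⟨Finset.mem_image_of_mem _ (hCD c hc), (hPv c v).2 (Or.inr ⟨hc, hvc⟩)⟩, ?_⟩
      rintro Q ⟨hQ, hvQ⟩
      obtain ⟨d, hd, rfl⟩ := Finset.mem_image.1 hQ
      rcases (hPv d v).1 hvQ with rfl | ⟨hdC, h⟩
      · exact absurd hd hv
      · rw [hinj (hleaf d hdC h) (hleaf c hc hvc)]
  · have hle : (D.image P).card ≤ D.card := Finset.card_image_le
    have h1 : (C.image l₁).card = C.card := Finset.card_image_of_injOn fun c hc d hd hcd =>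
      hinj (hl c hc).2.1 (by simpa only [hcd] using (hl d hd).2.1)
    have h2 : (C.image l₂).card = C.card := Finset.card_image_of_injOn fun c hc d hd hcd =>
      hinj (hl c hc).2.2 (by simpa only [hcd] using (hl d hd).2.2)
    have hdisj : Disjoint (C.image l₁) (C.image l₂) := by
      rw [Finset.disjoint_left]
      simp only [Finset.mem_image, not_exists, not_and]
      rintro _ ⟨c, hc, rfl⟩ d hd hcd
      have : c = d := hinj (hl c hc).2.1 (hcd ▸ (hl d hd).2.2)
      subst this
      exact (hl c hc).1 hcd.symm
    have h3 := Finset.card_sdiff_add_card_eq_card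
      (Finset.subset_univ (C.image l₁ ∪ C.image l₂))
    rw [← hD, Finset.card_union_of_disjoint hdisj, h1, h2, Finset.card_univ] at h3
    omega

theorem exists_isTotalForcingSet [Finite V] (hG : ∀ v, ∃ w, G.Adj v w) :
    ∃ S : Finset V, IsTotalForcingSet G (S : Set V) ∧ S.card = totalForcingNumber G := by
  have := Fintype.ofFinite V
  refine Nat.sInf_mem (s := {n | ∃ S : Finset V, IsTotalForcingSet G (S : Set V) ∧ S.card = n})
    ⟨_, Finset.univ, ⟨fun v => .initial v (by simp), fun v _ => ?_⟩, rfl⟩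
  obtain ⟨w, hw⟩ := hG v
  exact ⟨w, by simp, hw⟩

theorem IsPendantCover.le_totalForcingNumber [Finite V] (hG : ∀ v, ∃ w, G.Adj v w) {C : Set V}
    (h : IsPendantCover G C) : matchingNumber G + pathCoverNumber G ≤ totalForcingNumber G := by
  have := Fintype.ofFinite V
  obtain ⟨C, rfl⟩ : ∃ C' : Finset V, (C' : Set V) = C := (Set.toFinite C).exists_finset_coe
  obtain ⟨S, hS, hcard⟩ := exists_isTotalForcingSet hG
  obtain ⟨K, hK, hle⟩ := exists_isPathCover (C := C) h.exists_leaves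
  have hCS : C ⊆ S := Finset.coe_subset.1 (h.subset_of_isTotalForcingSet hS)
  have h1 := card_le_card_add_card hS.1 hCS fun u v huv => h.mem_or_mem huv
  have h2 := matchingNumber_le_card (C := C) fun u v huv => h.mem_or_mem huv
  have h3 : pathCoverNumber G ≤ K.card := Nat.sInf_le ⟨K, hK, rfl⟩
  omega

theorem le_totalForcingNumber_of_iso_top (φ : G ≃g (⊤ : SimpleGraph (Fin 2))) :
    matchingNumber G + pathCoverNumber G ≤ totalForcingNumber G := by
  have : Finite V := .of_equiv _ φ.toEquiv.symm
  set x := φ.symm 0 with hx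
  set y := φ.symm 1 with hy
  have hV : ∀ v, v = x ∨ v = y := by
    intro v
    rw [hx, hy, ← φ.injective.eq_iff, ← φ.injective.eq_iff, RelIso.apply_symm_apply,
      RelIso.apply_symm_apply]
    generalize φ v = i
    fin_cases i <;> simp
  have hxy : G.Adj x y := by
    rw [hx, hy, φ.symm.map_adj_iff]
    simp
  have hG : ∀ v, ∃ w, G.Adj v w := fun v => by
    rcases hV v with rfl | rfl
    · exact ⟨y, hxy⟩
    · exact ⟨x, hxy.symm⟩
  have h1 : matchingNumber G ≤ ({x} : Finset V).card := matchingNumber_le_card fun u v huv => by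
    rcases hV u with rfl | rfl
    · simp
    · rcases hV v with rfl | rfl
      · simp
      · exact absurd rfl huv.ne
  have h2 : pathCoverNumber G ≤ 1 := by
    refine Nat.sInf_le ⟨{(Walk.cons hxy .nil).toSubgraph}, ⟨?_, fun v => ?_⟩, by simp⟩
    · simp only [Finset.mem_singleton, forall_eq]
      exact ⟨x, y, _, by simp [hxy.ne], rfl⟩
    · refine ⟨_, ⟨Finset.mem_singleton_self _, ?_⟩, fun Q hQ => Finset.mem_singleton.1 hQ.1⟩
      rw [Walk.mem_verts_toSubgraph]
      simpa using hV v
  obtain ⟨S, hS, hcard⟩ := exists_isTotalForcingSet hG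
  have h3 : 1 < S.card := by
    have hne : ∃ v, v ∈ S := by
      by_contra! hemp
      have hno : ∀ v, ¬ Colored G (S : Set V) v := by
        intro v hv
        induction hv with
        | initial v hv => exact hemp v hv
        | force _ _ _ _ _ ih _ => exact ih
      exact hno x (hS.1 x)
    obtain ⟨v, hv⟩ := hne
    obtain ⟨w, hw, hvw⟩ := hS.2 v hv
    exact Finset.one_lt_card.2 ⟨v, hv, w, hw, hvw.ne⟩
  rw [Finset.card_singleton] at h1
  omega

theorem exists_isOptimalCover_length_le [Finite V] (G : SimpleGraph V) :
    ∃ L, IsOptimalCover G L ∧ L.length ≤ pathCoverNumber G := by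
  have := Fintype.ofFinite V
  obtain ⟨K, hK, -⟩ := exists_isPathCover (G := G) (C := ∅) (by simp)
  obtain ⟨K', hK', hcard⟩ := Nat.sInf_mem
    (s := {n | ∃ C : Finset G.Subgraph, IsPathCover G C ∧ C.card = n}) ⟨_, K, hK, rfl⟩
  obtain ⟨L, hL, hlen⟩ := hK'.exists_isListCover
  obtain ⟨M, hM⟩ := hL.exists_isOptimalCover
  exact ⟨M, hM, (hM.length_le L hL).trans (hlen.trans hcard).le⟩

end TotalForcing

theorem theorem2 {V : Type*} [Finite V] [Nontrivial V] (T : SimpleGraph V) (hT : T.IsTree) :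
    TotalForcing.totalForcingNumber T ≤
        TotalForcing.matchingNumber T + TotalForcing.pathCoverNumber T ∧
      (TotalForcing.totalForcingNumber T =
          TotalForcing.matchingNumber T + TotalForcing.pathCoverNumber T ↔
        TotalForcing.InFamily T) := by
  open TotalForcing in
  obtain ⟨L, hL, hlen⟩ := exists_isOptimalCover_length_le T
  have h1 := hL.totalForcingNumber_le_starts hT
  have h2 := length_starts_le_budget L
  have h3 := hL.budget_le
  have hle : totalForcingNumber T ≤ matchingNumber T + pathCoverNumber T := by omega
  refine ⟨hle, fun heq => ?_, fun hfam => hle.antisymm ?_⟩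
  · rcases iso_top_or_exists_isPendantCover hT hL (by omega) with h | ⟨C, hC⟩
    · exact Or.inl h
    · exact hC.inFamily hT
  · rcases hfam with ⟨⟨φ⟩⟩ | ⟨m, T', A, k, -, hA, hk, hk0, ⟨φ⟩⟩
    · exact le_totalForcingNumber_of_iso_top φ
    · obtain ⟨C, hC⟩ := exists_isPendantCover_of_iso (hA.imp_right And.left) hk hk0 φ
      exact hC.le_totalForcingNumber hT.connected.preconnected.exists_adj_of_nontrivial
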